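/- Define rational functions $$\Psi_3(x)=\frac{x^3(3x^2-7)^3(2x^2-7x+7)^3(11x^2-35x+28)^3}{1728\,(x^3-7x+7)^7},\qquad P_3=1-x+\frac{x^3}{7},$$ $$Q_3=\Bigl(1-\frac{3x^2}{7}\Bigr)\Bigl(1-x+\frac{2x^2}{7}\Bigr)\Bigl(1-\frac{5x}{4}+\frac{11x^2}{28}\Bigr),$$ and functions $$Y_0=\sqrt{1-\frac{2x}{3}},\quad Y_1=\left(\frac{21-8x^2+8\sqrt{7-\frac{21}{4}x^2+x^4}}{21+8\sqrt7}\right)^{1/4},\quad Y_2=\left(\frac{21-8x^2-8\sqrt{7-\frac{21}{4}x^2+x^4}}{21-8\sqrt7}\right)^{1/4},$$ where all roots and fractional powers are principal branches near $x=0$ (so that $Y_0=Y_1=Y_2=1$ at $x=0$). Let $${}_3F_2\!\left({a,\,b,\,c\atop d,\,e}\,\Big|\,z\right)=\sum_{n\ge 0}\frac{(a)_n(b)_n(c)_n}{(d)_n(e)_n\,n!}\,z^n .$$ Then there is a neighborhood of $x=0$ in $\mathbb{C}$ on which the three hypergeometric series below converge and the following identities hold: $$P_3^{1/6}\;{}_3F_2\!\left({-\frac1{42},\,\frac5{42},\,\frac{17}{42}\atop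 \frac13,\,\frac23}\,\Big|\,\Psi_3\right)=\frac12\,Y_0+\frac{3+\sqrt7}{12}\,Y_1+\frac{3-\sqrt7}{12}\,Y_2,$$ $$x\,Q_3P_3^{-13/6}\;{}_3F_2\!\left({\frac{13}{42},\,\frac{19}{42},\,\frac{31}{42}\atop \frac23,\,\frac43}\,\Big|\,\Psi_3\right)=-3\,Y_0+\frac{3+\sqrt7}{2}\,Y_1+\frac{3-\sqrt7}{2}\,Y_2,$$ $$x^2Q_3^2P_3^{-9/2}\;{}_3F_2\!\left({\frac9{14},\,\frac{11}{14},\,\frac{15}{14}\atop \frac43,\,\frac53}\,\Big|\,\Psi_3\right)=-2\sqrt7\,Y_1+2\sqrt7\,Y_2.$$ -/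

import Mathlib

open Filter Topology

noncomputable section

namespace DihedralEval

/-- The `n`-th term of the generalized hypergeometric series `₃F₂(a, b, c; d, e; z)`, that is
`(a)ₙ (b)ₙ (c)ₙ / ((d)ₙ (e)ₙ n!) zⁿ` with rising factorials. -/
def hyp32Term (a b c d e z : ℂ) (n : ℕ) : ℂ :=
  ((ascPochhammer ℂ n).eval a * (ascPochhammer ℂ n).eval b * (ascPochhammer ℂ n).eval c) /
    ((ascPochhammer ℂ n).eval d * (ascPochhammer ℂ n).eval e * (n.factorial : ℂ)) * z ^ n

/-- The generalized hypergeometric function `₃F₂(a, b, c; d, e; z)`, as the sum of its series. -/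
def hyp32 (a b c d e z : ℂ) : ℂ := ∑' n : ℕ, hyp32Term a b c d e z n

/-- The rational function `Ψ₃` of degree 21. -/
def Psi3 (x : ℂ) : ℂ :=
  (x ^ 3 * (3 * x ^ 2 - 7) ^ 3 * (2 * x ^ 2 - 7 * x + 7) ^ 3 * (11 * x ^ 2 - 35 * x + 28) ^ 3) /
    (1728 * (x ^ 3 - 7 * x + 7) ^ 7)

/-- The polynomial `P₃`. -/
def P3 (x : ℂ) : ℂ := 1 - x + x ^ 3 / 7

/-- The polynomial `Q₃`. -/
def Q3 (x : ℂ) : ℂ :=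
  (1 - 3 * x ^ 2 / 7) * (1 - x + 2 * x ^ 2 / 7) * (1 - 5 * x / 4 + 11 * x ^ 2 / 28)

/-- The positive square root of `7`, as a complex number. -/
def sqrt7 : ℂ := ((Real.sqrt 7 : ℝ) : ℂ)

/-- `√(7 - 21x²/4 + x⁴)`, principal branch (so its value at `0` is `√7`). -/
def S (x : ℂ) : ℂ := (7 - 21 / 4 * x ^ 2 + x ^ 4) ^ (1 / 2 : ℂ)

/-- The radical function `Y₀`. -/
def Y0 (x : ℂ) : ℂ := (1 - 2 * x / 3) ^ (1 / 2 : ℂ)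

/-- The dihedral function `Y₁`. The quantity under the fourth root is `1` at `x = 0`. -/
def Y1 (x : ℂ) : ℂ := ((21 - 8 * x ^ 2 + 8 * S x) / (21 + 8 * sqrt7)) ^ (1 / 4 : ℂ)

/-- The dihedral function `Y₂`. The quantity under the fourth root is `1` at `x = 0`. -/
def Y2 (x : ℂ) : ℂ := ((21 - 8 * x ^ 2 - 8 * S x) / (21 - 8 * sqrt7)) ^ (1 / 4 : ℂ)

end DihedralEval

end

noncomputable section

namespace DihedralEval

open Polynomial FormalMultilinearSeries

/-!
Up to constants the three left-hand sides are `P₃ ^ (1/6) Ψ₃ ^ (j/3) F (Ψ₃)` for `j = 0, 1, 2`,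
where the `z ^ (j/3) F` are the local solutions at `0` of one hypergeometric equation, with local
exponents `0, 1/3, 2/3` there. Pulled back along `Ψ₃`, which is ramified of order `3` over `0`
and of order `7` over `∞`, and twisted by `P₃ ^ (1/6)`, this equation becomes nonsingular at the
points over `0`. It also becomes nonsingular at the double points of `Ψ₃` over `1`, the roots of
`R`, and keeps as singular points over `1` only the simple ones, the roots of `T T₀`; this is the
identity `84 (P₃ ^ 7 + 49/27 (x Q₃) ^ 3) = R ^ 2 T T₀`. Logarithmic differentiation shows that
`Y₀`, `Y₁`, `Y₂` solve the resulting third order equation as well. Since `Ψ₃` vanishes to order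
`3` at `0`, each left-hand side agrees with its prefactor modulo `x ^ 3`, so comparing value and
first two derivatives at `0` determines the coefficients of the `Yᵢ`.
-/

section IteratedDerivatives

variable {𝕜 : Type*} [NontriviallyNormedField 𝕜]

theorem le_analyticOrderAt_sum {E ι : Type*} [NormedAddCommGroup E] [NormedSpace 𝕜 E]
    {s : Finset ι} {f : ι → 𝕜 → E} {z₀ : 𝕜} {k : ℕ∞}
    (h : ∀ i ∈ s, k ≤ analyticOrderAt (f i) z₀) : k ≤ analyticOrderAt (∑ i ∈ s, f i) z₀ := by
  refine Finset.sum_induction f (k ≤ analyticOrderAt · z₀)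
    (fun _ _ hf hg ↦ (le_min hf hg).trans le_analyticOrderAt_add) ?_ h
  exact le_top.trans_eq (analyticOrderAt_eq_top.2 (.of_forall fun _ ↦ rfl)).symm

theorem analyticAt_iteratedDeriv [CompleteSpace 𝕜] {f : 𝕜 → 𝕜} {z₀ : 𝕜}
    (hf : AnalyticAt 𝕜 f z₀) (i : ℕ) : AnalyticAt 𝕜 (iteratedDeriv i f) z₀ :=
  iteratedDeriv_eq_iterate (𝕜 := 𝕜) (f := f) ▸ hf.iterated_deriv i

theorem analyticOrderAt_iteratedDeriv [CompleteSpace 𝕜] [CharZero 𝕜] {f : 𝕜 → 𝕜} {z₀ : 𝕜}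
    (hf : AnalyticAt 𝕜 f z₀) {m i : ℕ} (hm : analyticOrderAt f z₀ = m) (hi : i ≤ m) :
    analyticOrderAt (iteratedDeriv i f) z₀ = (m - i : ℕ) := by
  rcases Nat.eq_zero_or_pos m with rfl | hpos
  · obtain rfl : i = 0 := by lia
    simpa using hm
  · rw [iteratedDeriv_eq_iterate]
    exact analyticOrderAt_iterated_deriv hf hm.symm hpos.ne' hi

theorem iteratedDeriv_mul_eq_of_le_analyticOrderAt [CompleteSpace 𝕜] [CharZero 𝕜]
    {f g : 𝕜 → 𝕜} {z₀ c : 𝕜} (hf : AnalyticAt 𝕜 f z₀) (hg : AnalyticAt 𝕜 g z₀) {n : ℕ}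
    (hn : n ≤ analyticOrderAt (fun z ↦ g z - c) z₀) {i : ℕ}
    (hi : i < n) : iteratedDeriv i (fun z ↦ f z * g z) z₀ = c * iteratedDeriv i f z₀ := by
  have hgc : AnalyticAt 𝕜 (fun z ↦ g z - c) z₀ := hg.sub analyticAt_const
  have horder : (n : ℕ∞) ≤ analyticOrderAt (f * fun z ↦ g z - c) z₀ := by
    rw [analyticOrderAt_mul hf hgc]
    exact hn.trans le_add_self
  have hsplit : (fun z ↦ f z * g z) = (f * fun z ↦ g z - c) + c • f := by
    funext z
    simp only [Pi.add_apply, Pi.mul_apply, Pi.smul_apply, smul_eq_mul]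
    ring
  rw [hsplit, iteratedDeriv_add (hf.mul hgc).contDiffAt hf.const_smul.contDiffAt,
    (natCast_le_analyticOrderAt_iff_iteratedDeriv_eq_zero (hf.mul hgc)).1 horder i hi, zero_add,
    iteratedDeriv_const_smul_field, smul_eq_mul]

theorem eventually_iteratedDeriv_eq {E : Type*} [NormedAddCommGroup E] [NormedSpace 𝕜 E]
    {s : Set 𝕜} (hs : IsOpen s) {z₀ : 𝕜} {F : ℕ → 𝕜 → E} {n : ℕ}
    (hF : ∀ k < n, ∀ᶠ z in 𝓝[s] z₀, HasDerivAt (F k) (F (k + 1) z) z) {k : ℕ} (hk : k ≤ n) :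
    ∀ᶠ z in 𝓝[s] z₀, iteratedDeriv k (F 0) z = F k z := by
  induction k with
  | zero => exact .of_forall fun z ↦ by rw [iteratedDeriv_zero]
  | succ k ih =>
    filter_upwards [eventually_eventually_nhdsWithin.2 (ih (by lia)), hF k (by lia),
      eventually_mem_nhdsWithin] with z hz hFz hzs
    rw [hs.nhdsWithin_eq hzs] at hz
    rw [iteratedDeriv_succ, EventuallyEq.deriv_eq hz, hFz.deriv]

theorem eventually_iteratedDeriv_eq_of_tower {s : Set 𝕜} (hs : IsOpen s) {z₀ : 𝕜}
    {U l k : ℕ → 𝕜 → 𝕜}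
    (hU : ∀ i < 3, ∀ᶠ z in 𝓝[s] z₀, HasDerivAt (U i) (l 0 z * U i z + k 0 z * U (i + 1) z) z)
    (hl : ∀ i < 2, ∀ᶠ z in 𝓝[s] z₀, HasDerivAt (l i) (l (i + 1) z) z)
    (hk : ∀ i < 2, ∀ᶠ z in 𝓝[s] z₀, HasDerivAt (k i) (k (i + 1) z) z) :
    ∀ᶠ z in 𝓝[s] z₀,
      iteratedDeriv 1 (U 0) z = l 0 z * U 0 z + k 0 z * U 1 z ∧
      iteratedDeriv 2 (U 0) z = (l 1 z + l 0 z ^ 2) * U 0 z +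
        (2 * l 0 z * k 0 z + k 1 z) * U 1 z + k 0 z ^ 2 * U 2 z ∧
      iteratedDeriv 3 (U 0) z = (l 2 z + 3 * l 0 z * l 1 z + l 0 z ^ 3) * U 0 z +
        (3 * l 0 z ^ 2 * k 0 z + 3 * l 1 z * k 0 z + 3 * l 0 z * k 1 z + k 2 z) * U 1 z +
        (3 * l 0 z * k 0 z ^ 2 + 3 * k 0 z * k 1 z) * U 2 z + k 0 z ^ 3 * U 3 z := by
  let F : ℕ → 𝕜 → 𝕜
    | 0 => U 0
    | 1 => l 0 * U 0 + k 0 * U 1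
    | 2 => (l 1 + l 0 ^ 2) * U 0 + (2 * l 0 * k 0 + k 1) * U 1 + k 0 ^ 2 * U 2
    | _ => (l 2 + 3 * l 0 * l 1 + l 0 ^ 3) * U 0 +
        (3 * l 0 ^ 2 * k 0 + 3 * l 1 * k 0 + 3 * l 0 * k 1 + k 2) * U 1 +
        (3 * l 0 * k 0 ^ 2 + 3 * k 0 * k 1) * U 2 + k 0 ^ 3 * U 3
  have hF : ∀ i < 3, ∀ᶠ z in 𝓝[s] z₀, HasDerivAt (F i) (F (i + 1) z) z := by
    intro i hi
    filter_upwards [hU 0 (by lia), hU 1 (by lia), hU 2 (by lia), hl 0 (by lia), hl 1 (by lia),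
      hk 0 (by lia), hk 1 (by lia)] with z hU0 hU1 hU2 hl0 hl1 hk0 hk1
    interval_cases i
    · exact hU0
    · refine ((hl0.mul hU0).add (hk0.mul hU1)).congr_deriv ?_
      simp only [F, Pi.add_apply, Pi.mul_apply, Pi.pow_apply, Pi.ofNat_apply]
      ring
    · refine ((((hl1.add (hl0.pow 2)).mul hU0).add
        ((((hl0.const_mul 2).mul hk0).add hk1).mul hU1)).add ((hk0.pow 2).mul hU2)).congr_deriv ?_
      simp only [F, Pi.add_apply, Pi.mul_apply, Pi.pow_apply, Pi.ofNat_apply]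
      push_cast
      ring
  filter_upwards [eventually_iteratedDeriv_eq hs hF (k := 1) (by lia),
    eventually_iteratedDeriv_eq hs hF (k := 2) (by lia),
    eventually_iteratedDeriv_eq hs hF (k := 3) (by lia)] with z h1 h2 h3
  exact ⟨h1, h2, h3⟩

theorem eventually_iteratedDeriv_eq_of_logDeriv {z₀ : 𝕜} {f : 𝕜 → 𝕜} {l : ℕ → 𝕜 → 𝕜}
    (hf : ∀ᶠ z in 𝓝 z₀, HasDerivAt f (l 0 z * f z) z)
    (hl : ∀ i < 2, ∀ᶠ z in 𝓝 z₀, HasDerivAt (l i) (l (i + 1) z) z) :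
    ∀ᶠ z in 𝓝 z₀,
      iteratedDeriv 1 f z = l 0 z * f z ∧
      iteratedDeriv 2 f z = (l 1 z + l 0 z ^ 2) * f z ∧
      iteratedDeriv 3 f z = (l 2 z + 3 * l 0 z * l 1 z + l 0 z ^ 3) * f z := by
  let U : ℕ → 𝕜 → 𝕜
    | 0 => f
    | _ => 0
  have h := eventually_iteratedDeriv_eq_of_tower (s := Set.univ) (z₀ := z₀) isOpen_univ
    (U := U) (l := l) (k := fun _ ↦ 0) ?_ ?_ ?_
  · simpa [U] using h
  · rintro (_ | i) -
    · simpa [U] using hf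
    · exact .of_forall fun z ↦ by simp [U, hasDerivAt_zero]
  · simpa using hl
  · exact fun _ _ ↦ .of_forall fun z ↦ hasDerivAt_const z (0 : 𝕜)

/-- The numerators of the successive derivatives of the rational function `p / q`: the `n`-th
derivative is `derivNum p q n / q ^ (n + 1)`. -/
def derivNum {R : Type*} [CommRing R] (p q : R[X]) : ℕ → R[X]
  | 0 => p
  | n + 1 => derivative (derivNum p q n) * q - (n + 1) * derivNum p q n * derivative q

/-- The `n`-th derivative of the rational function `p / q`. -/
def ratDeriv (p q : 𝕜[X]) (n : ℕ) (z : 𝕜) : 𝕜 := (derivNum p q n).eval z / q.eval z ^ (n + 1)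

theorem ratDeriv_zero (p q : 𝕜[X]) (z : 𝕜) : ratDeriv p q 0 z = p.eval z / q.eval z := by
  rw [ratDeriv, derivNum, zero_add, pow_one]

theorem hasDerivAt_ratDeriv (p q : 𝕜[X]) (n : ℕ) {z : 𝕜} (hz : q.eval z ≠ 0) :
    HasDerivAt (ratDeriv p q n) (ratDeriv p q (n + 1) z) z := by
  refine (((derivNum p q n).hasDerivAt z).div ((q.hasDerivAt z).pow (n + 1))
    (pow_ne_zero _ hz)).congr_deriv ?_
  simp only [ratDeriv, derivNum, eval_sub, eval_mul, eval_add, eval_natCast, eval_one,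
    Pi.pow_apply]
  push_cast
  field_simp
  ring

theorem hasDerivAt_cpow_of_logDeriv {f : ℂ → ℂ} {m x : ℂ} (c : ℂ) (hf : HasDerivAt f (m * f x) x)
    (hx : f x ∈ Complex.slitPlane) : HasDerivAt (fun y ↦ f y ^ c) (c * m * f x ^ c) x := by
  refine (hf.cpow_const hx).congr_deriv ?_
  rw [Complex.cpow_sub _ 1 (Complex.slitPlane_ne_zero hx), Complex.cpow_one]
  field_simp [Complex.slitPlane_ne_zero hx]

end IteratedDerivatives

section LinearODE

variable {𝕜 : Type*} [NontriviallyNormedField 𝕜]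

/-- The functions analytic at `z₀` that solve the linear differential equation
`∑ i ≤ n, a i * f⁽ⁱ⁾ = 0` on a punctured neighbourhood of `z₀`. -/
def analyticSolutions {n : ℕ} (a : Fin (n + 1) → 𝕜 → 𝕜) (z₀ : 𝕜) [CompleteSpace 𝕜] :
    Submodule 𝕜 (𝕜 → 𝕜) where
  carrier := {f | AnalyticAt 𝕜 f z₀ ∧
    ∀ᶠ z in 𝓝[≠] z₀, ∑ i, a i z * iteratedDeriv i f z = 0}
  zero_mem' := ⟨analyticAt_const, .of_forall fun z ↦ by simp [Pi.zero_def]⟩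
  add_mem' := by
    rintro f g ⟨hf, hf'⟩ ⟨hg, hg'⟩
    refine ⟨hf.add hg, ?_⟩
    filter_upwards [hf', hg', hf.eventually_analyticAt.filter_mono nhdsWithin_le_nhds,
      hg.eventually_analyticAt.filter_mono nhdsWithin_le_nhds] with z hfz hgz hfa hga
    simp only [iteratedDeriv_add hfa.contDiffAt hga.contDiffAt, mul_add, Finset.sum_add_distrib,
      hfz, hgz, add_zero]
  smul_mem' := by
    rintro c f ⟨hf, hf'⟩
    refine ⟨hf.const_smul, ?_⟩
    filter_upwards [hf', hf.eventually_analyticAt.filter_mono nhdsWithin_le_nhds] with z hfz hfa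
    have h (i : Fin (n + 1)) : iteratedDeriv i (c • f) z = c * iteratedDeriv i f z :=
      iteratedDeriv_const_smul hfa.contDiffAt c
    simp only [h, mul_left_comm _ c, ← Finset.mul_sum, hfz, mul_zero]

theorem eventuallyEq_zero_of_mem_analyticSolutions [CompleteSpace 𝕜] [CharZero 𝕜] {n : ℕ}
    {a : Fin (n + 1) → 𝕜 → 𝕜} {z₀ : 𝕜} {f : 𝕜 → 𝕜} (hf : f ∈ analyticSolutions a z₀)
    (ha : ∀ i, AnalyticAt 𝕜 (a i) z₀) (hlast : a (Fin.last n) z₀ ≠ 0)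
    (h0 : ∀ i < n, iteratedDeriv i f z₀ = 0) : f =ᶠ[𝓝 z₀] 0 := by
  obtain ⟨hfa, hode⟩ := hf
  rw [← natCast_le_analyticOrderAt_iff_iteratedDeriv_eq_zero hfa] at h0
  by_contra hne
  rw [EventuallyEq, Pi.zero_def, ← analyticOrderAt_eq_top] at hne
  obtain ⟨m, hm⟩ := ENat.ne_top_iff_exists.mp hne
  have hnm : n ≤ m := by simpa [← hm] using h0
  have hterm (i : Fin (n + 1)) : AnalyticAt 𝕜 (a i * iteratedDeriv i f) z₀ :=
    (ha i).mul (analyticAt_iteratedDeriv hfa i)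
  have horder (i : Fin (n + 1)) : analyticOrderAt (a i * iteratedDeriv i f) z₀ =
      analyticOrderAt (a i) z₀ + (m - i : ℕ) := by
    rw [analyticOrderAt_mul (ha i) (analyticAt_iteratedDeriv hfa i),
      analyticOrderAt_iteratedDeriv hfa hm.symm (by lia)]
  have hlow : ((m - n + 1 : ℕ) : ℕ∞) ≤
      analyticOrderAt (∑ i : Fin n, a i.castSucc * iteratedDeriv i f) z₀ :=
    le_analyticOrderAt_sum fun i _ ↦
      (Nat.cast_le.2 (by simp; lia)).trans (le_add_self.trans (horder i.castSucc).ge)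
  have hsum : (∑ i : Fin n, a i.castSucc * iteratedDeriv i f) =ᶠ[𝓝 z₀]
      -(a (Fin.last n) * iteratedDeriv n f) := by
    refine ((Finset.analyticAt_sum _ fun i _ ↦ hterm i.castSucc).frequently_eq_iff_eventually_eq
      (hterm (Fin.last n)).neg).1 (Eventually.frequently ?_)
    filter_upwards [hode] with z hz
    rw [Fin.sum_univ_castSucc] at hz
    simpa using eq_neg_of_add_eq_zero_left hz
  have hlead : analyticOrderAt (a (Fin.last n) * iteratedDeriv n f) z₀ = (m - n : ℕ) := by
    simpa [(ha _).analyticOrderAt_eq_zero.2 hlast] using horder (Fin.last n)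
  rw [analyticOrderAt_congr hsum, analyticOrderAt_neg, hlead, Nat.cast_le] at hlow
  lia

theorem eventuallyEq_of_mem_analyticSolutions [CompleteSpace 𝕜] [CharZero 𝕜] {n : ℕ}
    {a : Fin (n + 1) → 𝕜 → 𝕜} {z₀ : 𝕜} {f g : 𝕜 → 𝕜} (hf : f ∈ analyticSolutions a z₀)
    (hg : g ∈ analyticSolutions a z₀) (ha : ∀ i, AnalyticAt 𝕜 (a i) z₀)
    (hlast : a (Fin.last n) z₀ ≠ 0) (h0 : ∀ i < n, iteratedDeriv i f z₀ = iteratedDeriv i g z₀) :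
    f =ᶠ[𝓝 z₀] g := by
  have h := eventuallyEq_zero_of_mem_analyticSolutions (Submodule.sub_mem _ hf hg) ha hlast
    fun i hi ↦ by rw [iteratedDeriv_sub hf.1.contDiffAt hg.1.contDiffAt, h0 i hi, sub_self]
  filter_upwards [h] with z hz using sub_eq_zero.1 hz

end LinearODE

section Euler

variable {𝕜 : Type*} [NontriviallyNormedField 𝕜]

/-- The Euler operator `θ + s`, where `θ = z * d/dz`; conjugating `θ` by `z ^ s` yields it. -/
def euler (s : 𝕜) (f : 𝕜 → 𝕜) (z : 𝕜) : 𝕜 := z * deriv f z + s * f z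

theorem hasFPowerSeriesAt_ofScalars_iff {f : 𝕜 → 𝕜} {c : ℕ → 𝕜} :
    HasFPowerSeriesAt f (ofScalars 𝕜 c) 0 ↔ ∀ᶠ z in 𝓝 0, HasSum (fun n ↦ c n * z ^ n) (f z) := by
  simp only [hasFPowerSeriesAt_iff, coeff_ofScalars, zero_add, smul_eq_mul, mul_comm]

theorem analyticAt_euler [CompleteSpace 𝕜] {s : 𝕜} {f : 𝕜 → 𝕜} {z : 𝕜} (hf : AnalyticAt 𝕜 f z) :
    AnalyticAt 𝕜 (euler s f) z :=
  (analyticAt_id.mul hf.deriv).add (analyticAt_const.mul hf)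

theorem analyticAt_iterate_euler [CompleteSpace 𝕜] {s : 𝕜} {f : 𝕜 → 𝕜} {z : 𝕜}
    (hf : AnalyticAt 𝕜 f z) (k : ℕ) : AnalyticAt 𝕜 ((euler s)^[k] f) z :=
  Function.Iterate.rec (AnalyticAt 𝕜 · z) hf (fun _ ↦ analyticAt_euler) k

theorem eventually_hasSum_deriv [CompleteSpace 𝕜] {f : 𝕜 → 𝕜} {c : ℕ → 𝕜}
    (hf : HasFPowerSeriesAt f (ofScalars 𝕜 c) 0) :
    ∀ᶠ z in 𝓝 0, HasSum (fun n ↦ (n + 1) * c (n + 1) * z ^ n) (deriv f z) := by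
  obtain ⟨r, hr⟩ := hf
  have h := hasFPowerSeriesAt_iff.1 ⟨r, hr.fderiv⟩
  filter_upwards [h] with z hz
  have := ContinuousLinearMap.hasSum (ContinuousLinearMap.apply 𝕜 𝕜 (1 : 𝕜)) hz
  simpa [Function.comp_def, derivSeries_coeff_one, coeff_ofScalars, mul_comm, mul_assoc] using this

theorem hasFPowerSeriesAt_euler [CompleteSpace 𝕜] (s : 𝕜) {f : 𝕜 → 𝕜} {c : ℕ → 𝕜}
    (hf : HasFPowerSeriesAt f (ofScalars 𝕜 c) 0) :
    HasFPowerSeriesAt (euler s f) (ofScalars 𝕜 fun n ↦ (n + s) * c n) 0 := by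
  rw [hasFPowerSeriesAt_ofScalars_iff]
  filter_upwards [hasFPowerSeriesAt_ofScalars_iff.1 hf, eventually_hasSum_deriv hf] with z hz hz'
  have hθ : HasSum (fun n : ℕ ↦ n * c n * z ^ n) (z * deriv f z) := by
    refine (hasSum_nat_add_iff' 1).1 ?_
    simpa [pow_succ', mul_left_comm] using hz'.mul_left z
  simpa only [euler, add_mul, mul_assoc] using hθ.add (hz.mul_left s)

theorem hasFPowerSeriesAt_iterate_euler [CompleteSpace 𝕜] (s : 𝕜) {f : 𝕜 → 𝕜} {c : ℕ → 𝕜}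
    (hf : HasFPowerSeriesAt f (ofScalars 𝕜 c) 0) (k : ℕ) :
    HasFPowerSeriesAt ((euler s)^[k] f) (ofScalars 𝕜 fun n ↦ (n + s) ^ k * c n) 0 := by
  induction k with
  | zero => simpa using hf
  | succ k ih =>
    rw [Function.iterate_succ_apply']
    simpa only [pow_succ', mul_assoc] using hasFPowerSeriesAt_euler s ih

theorem eventually_sum_euler_eq [CompleteSpace 𝕜] {s : 𝕜} {f : 𝕜 → 𝕜} {c : ℕ → 𝕜}
    (hf : HasFPowerSeriesAt f (ofScalars 𝕜 c) 0) {N : ℕ} (a b : Fin N → 𝕜)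
    (hindicial : ∑ k, a k * s ^ (k : ℕ) = 0)
    (hrec : ∀ n : ℕ, (∑ k, a k * (n + 1 + s) ^ (k : ℕ)) * c (n + 1) =
      (∑ k, b k * (n + s) ^ (k : ℕ)) * c n) :
    ∀ᶠ z in 𝓝 0, ∑ k, a k * (euler s)^[k] f z = z * ∑ k, b k * (euler s)^[k] f z := by
  have hsum (e : Fin N → 𝕜) : ∀ᶠ z in 𝓝 0, HasSum
      (fun n : ℕ ↦ (∑ k, e k * (n + s) ^ (k : ℕ)) * c n * z ^ n)
      (∑ k, e k * (euler s)^[k] f z) := by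
    have h := eventually_all.2 fun k : Fin N ↦
      hasFPowerSeriesAt_ofScalars_iff.1 (hasFPowerSeriesAt_iterate_euler s hf k)
    filter_upwards [h] with z hz
    simpa only [Finset.sum_mul, mul_assoc] using
      hasSum_sum fun k _ ↦ (hz k).mul_left (e k)
  filter_upwards [hsum a, hsum b] with z hza hzb
  refine hza.unique ((hasSum_nat_add_iff' 1).1 ?_)
  simpa [hindicial, hrec, pow_succ', mul_left_comm] using hzb.mul_left z

theorem hasDerivAt_mul_comp_euler {M ψ f : 𝕜 → 𝕜} {l k s x : 𝕜}
    (hM : HasDerivAt M ((l + s * k) * M x) x) (hψ : HasDerivAt ψ (k * ψ x) x)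
    (hf : DifferentiableAt 𝕜 f (ψ x)) :
    HasDerivAt (fun y ↦ M y * f (ψ y)) (l * (M x * f (ψ x)) + k * (M x * euler s f (ψ x))) x := by
  refine (hM.mul (hf.hasDerivAt.comp x hψ)).congr_deriv ?_
  simp only [euler, Function.comp_apply]
  ring

end Euler

section Hypergeometric

/-- The coefficient of `z ^ n` in the series `₃F₂(a, b, c; d, e; z)`. -/
def hyp32Coeff (a b c d e : ℂ) (n : ℕ) : ℂ :=
  ((ascPochhammer ℂ n).eval a * (ascPochhammer ℂ n).eval b * (ascPochhammer ℂ n).eval c) /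
    ((ascPochhammer ℂ n).eval d * (ascPochhammer ℂ n).eval e * (n.factorial : ℂ))

variable {a b c d e : ℂ}

theorem hyp32Coeff_zero : hyp32Coeff a b c d e 0 = 1 := by simp [hyp32Coeff]

theorem hyp32Coeff_succ (n : ℕ) :
    hyp32Coeff a b c d e (n + 1) =
      (a + n) / (d + n) * ((b + n) / (e + n)) * ((c + n) / (1 + n)) * hyp32Coeff a b c d e n := by
  simp only [hyp32Coeff, ascPochhammer_succ_eval, Nat.factorial_succ, Nat.cast_mul,
    Nat.cast_succ, div_eq_mul_inv, mul_inv]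
  ring

theorem hyp32Coeff_rec (hd : ∀ n : ℕ, d + n ≠ 0) (he : ∀ n : ℕ, e + n ≠ 0) (n : ℕ) :
    (n + 1) * (n + d) * (n + e) * hyp32Coeff a b c d e (n + 1) =
      (n + a) * (n + b) * (n + c) * hyp32Coeff a b c d e n := by
  have h1 : (1 + n : ℂ) ≠ 0 := by exact_mod_cast (by lia : 1 + n ≠ 0)
  rw [hyp32Coeff_succ]
  field_simp [hd n, he n]
  ring

theorem summable_hyp32Term {z : ℂ} (hz : ‖z‖ < 1) : Summable (hyp32Term a b c d e z) := by
  obtain ⟨r, hzr, hr⟩ := exists_between hz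
  have hquot (u v : ℂ) : Tendsto (fun n : ℕ ↦ (u + n) / (v + n)) atTop (𝓝 1) := by
    simpa using tendsto_add_mul_div_add_mul_atTop_nhds u v 1 (one_ne_zero (α := ℂ))
  have hlim := ((((hquot a d).mul (hquot b e)).mul (hquot c 1)).mul_const z).norm
  rw [one_mul, one_mul, one_mul] at hlim
  refine summable_of_ratio_norm_eventually_le hr ?_
  filter_upwards [hlim.eventually_le_const hzr] with n hn
  calc ‖hyp32Term a b c d e z (n + 1)‖
      = ‖(a + n) / (d + n) * ((b + n) / (e + n)) * ((c + n) / (1 + n)) * z *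
          hyp32Term a b c d e z n‖ := by
        change ‖hyp32Coeff a b c d e (n + 1) * z ^ (n + 1)‖ = ‖_ * (hyp32Coeff a b c d e n * z ^ n)‖
        rw [hyp32Coeff_succ, pow_succ']
        ring_nf
    _ ≤ r * ‖hyp32Term a b c d e z n‖ := by
        rw [norm_mul]
        gcongr

theorem hasFPowerSeriesAt_hyp32 :
    HasFPowerSeriesAt (hyp32 a b c d e) (ofScalars ℂ (hyp32Coeff a b c d e)) 0 := by
  refine hasFPowerSeriesAt_ofScalars_iff.2 ?_
  filter_upwards [Metric.ball_mem_nhds 0 one_pos] with z hz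
  exact (summable_hyp32Term (mem_ball_zero_iff.1 hz)).hasSum

theorem hyp32_zero : hyp32 a b c d e 0 = 1 := by
  have h := (hasFPowerSeriesAt_hyp32 (a := a) (b := b) (c := c) (d := d) (e := e)).coeff_zero 0
  simpa [hyp32Coeff_zero] using h.symm

theorem add_natCast_ne_zero_of_re_pos {d : ℂ} (hd : 0 < d.re) (n : ℕ) : d + n ≠ 0 := by
  intro h
  have := congrArg Complex.re h
  rw [Complex.add_re, Complex.natCast_re, Complex.zero_re] at this
  linarith [n.cast_nonneg (α := ℝ)]

theorem eventually_sum_euler_hyp32_eq (hd : ∀ n : ℕ, d + n ≠ 0) (he : ∀ n : ℕ, e + n ≠ 0) {s : ℂ}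
    {N : ℕ} (p q : Fin N → ℂ)
    (hp : ∀ x, ∑ k, p k * (x + 1 + s) ^ (k : ℕ) = (x + 1) * (x + d) * (x + e))
    (hq : ∀ x, ∑ k, q k * (x + s) ^ (k : ℕ) = (x + a) * (x + b) * (x + c)) :
    ∀ᶠ z in 𝓝 0, ∑ k, p k * (euler s)^[k] (hyp32 a b c d e) z =
      z * ∑ k, q k * (euler s)^[k] (hyp32 a b c d e) z := by
  refine eventually_sum_euler_eq hasFPowerSeriesAt_hyp32 p q ?_ fun n ↦ ?_
  · simpa using hp (-1)
  · rw [hp, hq, hyp32Coeff_rec hd he]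

end Hypergeometric

section Polynomials

/-- `P₃` as a formal polynomial. -/
def polyP : ℂ[X] := 1 - X + C (1 / 7) * X ^ 3

/-- The polynomial `x Q₃`, whose roots lie over `Ψ₃ = 0` and are triple there. -/
def polyB : ℂ[X] :=
  X * (1 - C (3 / 7) * X ^ 2) * (1 - X + C (2 / 7) * X ^ 2) *
    (1 - C (5 / 4) * X + C (11 / 28) * X ^ 2)

/-- The polynomial whose roots are the double points of `Ψ₃` over `Ψ₃ = 1`. -/
def polyR : ℂ[X] :=
  1 - C (19 / 6) * X + C (15 / 4) * X ^ 2 - X ^ 3 - C (65 / 28) * X ^ 4 + C (125 / 42) * X ^ 5 -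
    C (45 / 28) * X ^ 6 + C (3 / 7) * X ^ 7 - C (9 / 196) * X ^ 8

/-- The multiple `28 - 21 x² + 4 x⁴` of the radicand of `S`; its roots are simple points of `Ψ₃`
over `Ψ₃ = 1`. -/
def polyT : ℂ[X] := 28 - 21 * X ^ 2 + 4 * X ^ 4

/-- The multiple `3 - 2 x` of the radicand of `Y₀`; its root is a simple point of `Ψ₃` over
`Ψ₃ = 1`. -/
def polyT₀ : ℂ[X] := 3 - 2 * X

/-- The coefficients of the third order differential equation with solutions `Y₀`, `Y₁`, `Y₂`. -/
def dihedralCoeff : Fin 4 → ℂ[X] :=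
  ![3 * X ^ 5 - 49 * X ^ 3 + 105 * X ^ 2 - 63 * X,
    -18 * X ^ 6 + 9 * X ^ 5 + 238 * X ^ 4 - 525 * X ^ 3 + 231 * X ^ 2 + 252 * X - 196,
    -36 * X ^ 7 + 36 * X ^ 6 + 427 * X ^ 5 - 840 * X ^ 4 - 441 * X ^ 3 + 1953 * X ^ 2 - 1127 * X,
    7 * polyP * polyT * polyT₀]

/-- The numerators of the functions `logDerivP n`. -/
def logDerivNumP : ℕ → ℂ[X] := derivNum (C (1 / 6) * derivative polyP) polyP

/-- The derivatives of `P₃' / (6 P₃)`, the logarithmic derivative of `P₃ ^ (1 / 6)`. -/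
def logDerivP : ℕ → ℂ → ℂ := ratDeriv (C (1 / 6) * derivative polyP) polyP

/-- The numerators of the functions `logDerivPsi n`. -/
def logDerivNumPsi : ℕ → ℂ[X] := derivNum (3 * polyR) (polyB * polyP)

/-- The derivatives of `3 R / (x Q₃ P₃)`, the logarithmic derivative of `Ψ₃`. -/
def logDerivPsi : ℕ → ℂ → ℂ := ratDeriv (3 * polyR) (polyB * polyP)

theorem polyR_eq :
    polyR = derivative polyB * polyP - C (7 / 3) * (polyB * derivative polyP) := by
  refine Polynomial.funext fun x ↦ ?_
  simp only [polyR, polyB, polyP, derivative_add, derivative_sub, derivative_mul, derivative_X_pow,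
    derivative_X, derivative_C, derivative_one, eval_add, eval_sub, eval_mul, eval_pow, eval_X,
    eval_C, eval_one, eval_zero, Nat.cast_ofNat, Nat.reduceSub]
  ring

theorem polyP_pow_add_polyB_pow (x : ℂ) :
    84 * (polyP.eval x ^ 7 + 49 / 27 * polyB.eval x ^ 3) =
      polyR.eval x ^ 2 * polyT.eval x * polyT₀.eval x := by
  simp only [polyR, polyB, polyP, polyT, polyT₀, eval_add, eval_sub, eval_mul, eval_pow, eval_X,
    eval_C, eval_one, eval_ofNat]
  ring

/-! With denominators cleared, the coefficients of `H`, `(θ + j/3) H` and `(θ + j/3)² H` in the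
dihedral equation for `P₃ ^ (1/6) Ψ₃ ^ (j/3) H (Ψ₃)` after `(θ + j/3)³ H` has been eliminated. -/

theorem pullback_identity_zero (x : ℂ) :
    7 * polyT.eval x * polyT₀.eval x *
        ((logDerivNumP 2).eval x + 3 * (logDerivNumP 0).eval x * (logDerivNumP 1).eval x +
          (logDerivNumP 0).eval x ^ 3) +
      595 / 18 * polyR.eval x +
      (dihedralCoeff 2).eval x * ((logDerivNumP 1).eval x + (logDerivNumP 0).eval x ^ 2) +
      (dihedralCoeff 1).eval x * (logDerivNumP 0).eval x * polyP.eval x +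
      (dihedralCoeff 0).eval x * polyP.eval x ^ 2 = 0 := by
  simp only [dihedralCoeff, logDerivNumP, derivNum, polyR, polyP, polyT, polyT₀, Matrix.cons_val,
    derivative_add, derivative_sub, derivative_mul, derivative_X_pow, derivative_X, derivative_C,
    derivative_one, derivative_natCast, derivative_zero, eval_add, eval_sub, eval_mul, eval_pow,
    eval_X, eval_C, eval_one, eval_ofNat, eval_neg, eval_zero, eval_natCast, Nat.cast_ofNat,
    Nat.reduceSub]
  ring

theorem pullback_identity_one (x : ℂ) :
    7 * polyT.eval x * polyT₀.eval x *
        (9 * (logDerivNumP 0).eval x ^ 2 * polyR.eval x * polyB.eval x ^ 2 +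
          9 * (logDerivNumP 1).eval x * polyR.eval x * polyB.eval x ^ 2 +
          3 * (logDerivNumP 0).eval x * (logDerivNumPsi 1).eval x * polyB.eval x +
          (logDerivNumPsi 2).eval x) -
      15876 * polyR.eval x * (2 / 9 * polyP.eval x ^ 7 + 7 / 108 * polyB.eval x ^ 3) +
      (dihedralCoeff 2).eval x * polyB.eval x *
        (6 * (logDerivNumP 0).eval x * polyR.eval x * polyB.eval x + (logDerivNumPsi 1).eval x) +
      3 * (dihedralCoeff 1).eval x * polyR.eval x * polyB.eval x ^ 2 * polyP.eval x = 0 := by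
  simp only [dihedralCoeff, logDerivNumP, logDerivNumPsi, derivNum, polyR, polyB, polyP, polyT,
    polyT₀, Matrix.cons_val, derivative_add, derivative_sub, derivative_mul, derivative_X_pow,
    derivative_X, derivative_C, derivative_one, derivative_ofNat, derivative_natCast,
    derivative_zero, eval_add, eval_sub, eval_mul, eval_pow, eval_X, eval_C, eval_one, eval_ofNat,
    eval_neg, eval_zero, eval_natCast, Nat.cast_ofNat, Nat.reduceSub]
  ring

theorem pullback_identity_two (x : ℂ) :
    7 * polyT.eval x * polyT₀.eval x *
        (9 * (logDerivNumP 0).eval x * polyR.eval x * polyB.eval x +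
          3 * (logDerivNumPsi 1).eval x) +
      5292 * (polyP.eval x ^ 7 - 49 / 54 * polyB.eval x ^ 3) +
      3 * (dihedralCoeff 2).eval x * polyR.eval x * polyB.eval x = 0 := by
  simp only [dihedralCoeff, logDerivNumP, logDerivNumPsi, derivNum, polyR, polyB, polyP, polyT,
    polyT₀, Matrix.cons_val, derivative_add, derivative_sub, derivative_mul, derivative_X_pow,
    derivative_X, derivative_C, derivative_one, derivative_ofNat, eval_add, eval_sub,
    eval_mul, eval_pow, eval_X, eval_C, eval_one, eval_ofNat, eval_neg, eval_zero, eval_natCast,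
    Nat.cast_ofNat, Nat.reduceSub]
  ring

end Polynomials

section Pullback

theorem P3_eq (x : ℂ) : P3 x = polyP.eval x := by
  simp only [P3, polyP, eval_add, eval_sub, eval_one, eval_X, eval_mul, eval_C, eval_pow]
  ring

theorem mul_Q3_eq (x : ℂ) : x * Q3 x = polyB.eval x := by
  simp only [Q3, polyB, eval_mul, eval_X, eval_sub, eval_one, eval_C, eval_pow, eval_add]
  ring

theorem Psi3_eq (x : ℂ) : Psi3 x = -(49 / 27) * polyB.eval x ^ 3 / polyP.eval x ^ 7 := by
  have hnum : x ^ 3 * (3 * x ^ 2 - 7) ^ 3 * (2 * x ^ 2 - 7 * x + 7) ^ 3 *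
      (11 * x ^ 2 - 35 * x + 28) ^ 3 = (-1372 * polyB.eval x) ^ 3 := by
    simp only [polyB, eval_mul, eval_X, eval_sub, eval_one, eval_C, eval_pow, eval_add]
    ring
  have hden : x ^ 3 - 7 * x + 7 = 7 * polyP.eval x := by
    simp only [polyP, eval_add, eval_sub, eval_one, eval_X, eval_mul, eval_C, eval_pow]
    ring
  rw [Psi3, hnum, hden]
  ring

theorem hasDerivAt_Psi3 {x : ℂ} (hP : polyP.eval x ≠ 0) :
    HasDerivAt Psi3 (logDerivPsi 0 x * Psi3 x) x := by
  rw [funext Psi3_eq]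
  refine ((((polyB.hasDerivAt x).pow 3).const_mul (-(49 / 27))).div
    ((polyP.hasDerivAt x).pow 7) (pow_ne_zero _ hP)).congr_deriv ?_
  simp only [logDerivPsi, ratDeriv_zero, polyR_eq, eval_mul, eval_sub, eval_C, eval_ofNat,
    Pi.pow_apply]
  field_simp
  ring

theorem eventually_polyB_ne_zero : ∀ᶠ x in 𝓝[≠] 0, polyB.eval x ≠ 0 :=
  (polyB.hasDerivAt 0).eventually_ne (by simp [polyB])

theorem eventually_P3_mem_slitPlane : ∀ᶠ x in 𝓝 0, P3 x ∈ Complex.slitPlane := by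
  rw [funext P3_eq]
  exact polyP.continuous.continuousAt.eventually
    (Complex.isOpen_slitPlane.mem_nhds (by simp [polyP]))

theorem eventually_polyP_ne_zero : ∀ᶠ x in 𝓝 0, polyP.eval x ≠ 0 := by
  filter_upwards [eventually_P3_mem_slitPlane] with x hx
  exact P3_eq x ▸ Complex.slitPlane_ne_zero hx

theorem analyticAt_Psi3 : AnalyticAt ℂ Psi3 0 := by
  rw [funext Psi3_eq]
  exact (analyticAt_const.mul (polyB.differentiable.analyticAt 0 |>.pow 3)).div
    (polyP.differentiable.analyticAt 0 |>.pow 7) (by simp [polyP])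

theorem Psi3_zero : Psi3 0 = 0 := by simp [Psi3]

theorem hasDerivAt_P3_cpow (c : ℂ) {x : ℂ} (hx : P3 x ∈ Complex.slitPlane) :
    HasDerivAt (fun y ↦ P3 y ^ c)
      (ratDeriv (C c * derivative polyP) polyP 0 x * P3 x ^ c) x := by
  have hP0 : polyP.eval x ≠ 0 := P3_eq x ▸ Complex.slitPlane_ne_zero hx
  have hP : HasDerivAt P3 ((derivative polyP).eval x / polyP.eval x * P3 x) x := by
    rw [P3_eq, div_mul_cancel₀ _ hP0, funext P3_eq]
    exact polyP.hasDerivAt x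
  simpa only [ratDeriv_zero, eval_mul, eval_C, mul_div_assoc] using
    hasDerivAt_cpow_of_logDeriv c hP hx

theorem analyticAt_P3_cpow (c : ℂ) : AnalyticAt ℂ (fun x ↦ P3 x ^ c) 0 := by
  have hP : AnalyticAt ℂ P3 0 := funext P3_eq ▸ polyP.differentiable.analyticAt 0
  exact hP.cpow analyticAt_const (by simp [P3])

/-- The factor `(x Q₃)ʲ P₃ ^ (1/6 - 7j/3)` in front of the hypergeometric function whose exponents
at the origin are shifted by `j / 3`; up to a constant it is `P₃ ^ (1/6) Ψ₃ ^ (j/3)`. -/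
def prefactor (j : ℕ) (x : ℂ) : ℂ := polyB.eval x ^ j * P3 x ^ (1 / 6 - 7 / 3 * j : ℂ)

theorem analyticAt_prefactor (j : ℕ) : AnalyticAt ℂ (prefactor j) 0 :=
  (polyB.differentiable.analyticAt 0 |>.pow j).mul (analyticAt_P3_cpow _)

theorem hasDerivAt_prefactor (j : ℕ) {x : ℂ} (hB : polyB.eval x ≠ 0)
    (hP : P3 x ∈ Complex.slitPlane) :
    HasDerivAt (prefactor j)
      ((logDerivP 0 x + j / 3 * logDerivPsi 0 x) * prefactor j x) x := by
  have hP0 : polyP.eval x ≠ 0 := P3_eq x ▸ Complex.slitPlane_ne_zero hP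
  refine (((polyB.hasDerivAt x).pow j).mul (hasDerivAt_P3_cpow _ hP)).congr_deriv ?_
  simp only [logDerivP, logDerivPsi, ratDeriv_zero, prefactor, polyR_eq, eval_mul, eval_sub,
    eval_C, eval_ofNat, Pi.pow_apply]
  rcases j with _ | j
  · simp only [Nat.cast_zero, pow_zero, mul_zero, zero_mul, sub_zero]
    ring
  · push_cast
    field_simp
    ring

theorem eventually_hasDerivAt_logDerivP (i : ℕ) :
    ∀ᶠ x in 𝓝 0, HasDerivAt (logDerivP i) (logDerivP (i + 1) x) x :=
  eventually_polyP_ne_zero.mono fun _ ↦ hasDerivAt_ratDeriv _ _ i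

theorem eventually_hasDerivAt_logDerivPsi (i : ℕ) :
    ∀ᶠ x in 𝓝[≠] 0, HasDerivAt (logDerivPsi i) (logDerivPsi (i + 1) x) x := by
  filter_upwards [eventually_polyB_ne_zero, nhdsWithin_le_nhds eventually_polyP_ne_zero]
    with x hB hP
  exact hasDerivAt_ratDeriv _ _ i (by simpa only [eval_mul] using mul_ne_zero hB hP)

theorem tendsto_Psi3 : Tendsto Psi3 (𝓝 0) (𝓝 0) := by
  simpa only [Psi3_zero] using analyticAt_Psi3.continuousAt.tendsto

theorem eventually_hasDerivAt_prefactor_mul_comp_euler (j i : ℕ) {f : ℂ → ℂ}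
    (hf : AnalyticAt ℂ f 0) :
    ∀ᶠ x in 𝓝[≠] 0,
      HasDerivAt (fun x ↦ prefactor j x * (euler (j / 3 : ℂ))^[i] f (Psi3 x))
        (logDerivP 0 x * (prefactor j x * (euler (j / 3 : ℂ))^[i] f (Psi3 x)) +
          logDerivPsi 0 x * (prefactor j x * (euler (j / 3 : ℂ))^[i + 1] f (Psi3 x))) x := by
  filter_upwards [eventually_polyB_ne_zero, nhdsWithin_le_nhds eventually_P3_mem_slitPlane,
    nhdsWithin_le_nhds (tendsto_Psi3.eventually hf.eventually_analyticAt)] with x hB hP hfx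
  rw [Function.iterate_succ_apply']
  exact hasDerivAt_mul_comp_euler (hasDerivAt_prefactor j hB hP)
    (hasDerivAt_Psi3 (P3_eq x ▸ Complex.slitPlane_ne_zero hP))
    (analyticAt_iterate_euler hfx i).differentiableAt

/-- The solutions near `0` of the differential equation with coefficients `dihedralCoeff`. -/
def dihedralSolutions : Submodule ℂ (ℂ → ℂ) :=
  analyticSolutions (fun i x ↦ (dihedralCoeff i).eval x) 0

theorem dihedralCoeff_combination_eq_zero {x u₀ u₁ u₂ u₃ : ℂ} (hB : polyB.eval x ≠ 0)
    (hP : polyP.eval x ≠ 0)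
    (hu : u₃ - u₂ + 2 / 9 * u₁ = Psi3 x * (u₃ + 1 / 2 * u₂ + 1 / 28 * u₁ - 85 / 74088 * u₀)) :
    (dihedralCoeff 0).eval x * u₀ +
      (dihedralCoeff 1).eval x * (logDerivP 0 x * u₀ + logDerivPsi 0 x * u₁) +
      (dihedralCoeff 2).eval x *
        ((logDerivP 1 x + logDerivP 0 x ^ 2) * u₀ +
          (2 * logDerivP 0 x * logDerivPsi 0 x + logDerivPsi 1 x) * u₁ +
          logDerivPsi 0 x ^ 2 * u₂) +
      (dihedralCoeff 3).eval x *
        ((logDerivP 2 x + 3 * logDerivP 0 x * logDerivP 1 x + logDerivP 0 x ^ 3) * u₀ +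
          (3 * logDerivP 0 x ^ 2 * logDerivPsi 0 x + 3 * logDerivP 1 x * logDerivPsi 0 x +
            3 * logDerivP 0 x * logDerivPsi 1 x + logDerivPsi 2 x) * u₁ +
          (3 * logDerivP 0 x * logDerivPsi 0 x ^ 2 + 3 * logDerivPsi 0 x * logDerivPsi 1 x) * u₂ +
          logDerivPsi 0 x ^ 3 * u₃) = 0 := by
  have hP_num (n : ℕ) : logDerivP n x = (logDerivNumP n).eval x / polyP.eval x ^ (n + 1) := rfl
  have hPsi_num (n : ℕ) :
      logDerivPsi n x = (logDerivNumPsi n).eval x / (polyB * polyP).eval x ^ (n + 1) := rfl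
  have hPsi_num_zero : (logDerivNumPsi 0).eval x = 3 * polyR.eval x := by
    simp [logDerivNumPsi, derivNum]
  have hA₃ : (dihedralCoeff 3).eval x = 7 * polyP.eval x * polyT.eval x * polyT₀.eval x := by
    simp [dihedralCoeff]
  rw [Psi3_eq] at hu
  simp only [hP_num, hPsi_num, hPsi_num_zero, hA₃, eval_mul, zero_add, pow_one, Nat.reduceAdd]
  field_simp at hu ⊢
  linear_combination polyB.eval x ^ 3 * u₀ * pullback_identity_zero x +
    u₁ * pullback_identity_one x + 3 * polyR.eval x * u₂ * pullback_identity_two x -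
    189 * polyR.eval x * u₃ * polyP_pow_add_polyB_pow x +
    15876 * polyR.eval x / (2 * 9 * 27 * 28 * 74088) * hu

theorem prefactor_mul_comp_Psi3_mem_dihedralSolutions {f : ℂ → ℂ} (j : ℕ) (hf : AnalyticAt ℂ f 0)
    (hode : ∀ᶠ z in 𝓝 0,
      (euler (j / 3 : ℂ))^[3] f z - (euler (j / 3 : ℂ))^[2] f z + 2 / 9 * euler (j / 3 : ℂ) f z =
        z * ((euler (j / 3 : ℂ))^[3] f z + 1 / 2 * (euler (j / 3 : ℂ))^[2] f z +
          1 / 28 * euler (j / 3 : ℂ) f z - 85 / 74088 * f z)) :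
    (fun x ↦ prefactor j x * f (Psi3 x)) ∈ dihedralSolutions := by
  refine ⟨(analyticAt_prefactor j).mul (AnalyticAt.comp (by rwa [Psi3_zero]) analyticAt_Psi3), ?_⟩
  let U (i : ℕ) (x : ℂ) : ℂ := prefactor j x * (euler (j / 3 : ℂ))^[i] f (Psi3 x)
  have htower := eventually_iteratedDeriv_eq_of_tower (U := U) isOpen_compl_singleton
    (fun i _ ↦ eventually_hasDerivAt_prefactor_mul_comp_euler j i hf)
    (fun i _ ↦ nhdsWithin_le_nhds (eventually_hasDerivAt_logDerivP i))
    (fun i _ ↦ eventually_hasDerivAt_logDerivPsi i)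
  filter_upwards [htower, eventually_polyB_ne_zero, nhdsWithin_le_nhds eventually_polyP_ne_zero,
    nhdsWithin_le_nhds (tendsto_Psi3.eventually hode)] with x ⟨h1, h2, h3⟩ hB hP hode
  have hu : U 3 x - U 2 x + 2 / 9 * U 1 x =
      Psi3 x * (U 3 x + 1 / 2 * U 2 x + 1 / 28 * U 1 x - 85 / 74088 * U 0 x) := by
    simp only [U, Function.iterate_one, Function.iterate_zero, id_eq]
    linear_combination prefactor j x * hode
  refine (Fin.sum_univ_four _).trans ?_
  have h := dihedralCoeff_combination_eq_zero hB hP hu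
  rw [← h1, ← h2, ← h3] at h
  rwa [← iteratedDeriv_zero (f := U 0)] at h

end Pullback

section AlgebraicSolutions

theorem mem_dihedralSolutions_of_logDeriv {f : ℂ → ℂ} {l : ℕ → ℂ → ℂ}
    (hf : ∀ᶠ x in 𝓝 0, HasDerivAt f (l 0 x * f x) x)
    (hl : ∀ i < 2, ∀ᶠ x in 𝓝 0, HasDerivAt (l i) (l (i + 1) x) x)
    (hode : ∀ᶠ x in 𝓝 0, (dihedralCoeff 0).eval x + (dihedralCoeff 1).eval x * l 0 x +
      (dihedralCoeff 2).eval x * (l 1 x + l 0 x ^ 2) +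
      (dihedralCoeff 3).eval x * (l 2 x + 3 * l 0 x * l 1 x + l 0 x ^ 3) = 0) :
    f ∈ dihedralSolutions := by
  refine ⟨Complex.analyticAt_iff_eventually_differentiableAt.2
    (hf.mono fun x h ↦ h.differentiableAt), nhdsWithin_le_nhds ?_⟩
  filter_upwards [eventually_iteratedDeriv_eq_of_logDeriv hf hl, hode] with x ⟨h1, h2, h3⟩ hode
  refine (Fin.sum_univ_four _).trans ?_
  change _ * iteratedDeriv 0 f x + _ * iteratedDeriv 1 f x + _ * iteratedDeriv 2 f x +
    _ * iteratedDeriv 3 f x = 0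
  rw [iteratedDeriv_zero, h1, h2, h3]
  linear_combination f x * hode

theorem eventually_polyT₀_ne_zero : ∀ᶠ x in 𝓝 0, polyT₀.eval x ≠ 0 :=
  polyT₀.continuous.continuousAt.eventually_ne (by simp [polyT₀])

theorem eventually_hasDerivAt_Y0 :
    ∀ᶠ x in 𝓝 0, HasDerivAt Y0 (ratDeriv (-1) polyT₀ 0 x * Y0 x) x := by
  have hcont : ContinuousAt (fun x : ℂ ↦ 1 - 2 * x / 3) 0 := by fun_prop
  filter_upwards [eventually_polyT₀_ne_zero,
    hcont.eventually (Complex.isOpen_slitPlane.mem_nhds (by simp))] with x hx hslit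
  have hbase : HasDerivAt (fun x : ℂ ↦ 1 - 2 * x / 3)
      (-2 / polyT₀.eval x * (1 - 2 * x / 3)) x := by
    refine ((((hasDerivAt_id x).const_mul 2).div_const 3).const_sub 1).congr_deriv ?_
    field_simp
    simp [polyT₀]
  refine (hasDerivAt_cpow_of_logDeriv (1 / 2) hbase hslit).congr_deriv ?_
  simp only [ratDeriv_zero, eval_neg, eval_one, Y0]
  ring

theorem Y0_mem_dihedralSolutions : Y0 ∈ dihedralSolutions := by
  refine mem_dihedralSolutions_of_logDeriv eventually_hasDerivAt_Y0
    (fun i _ ↦ eventually_polyT₀_ne_zero.mono fun x ↦ hasDerivAt_ratDeriv _ _ i) ?_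
  filter_upwards [eventually_polyT₀_ne_zero] with x hx
  have hident : (dihedralCoeff 0).eval x * polyT₀.eval x ^ 2 - (dihedralCoeff 1).eval x *
      polyT₀.eval x - (dihedralCoeff 2).eval x = 21 * (polyP.eval x * polyT.eval x) := by
    simp only [dihedralCoeff, polyP, polyT, polyT₀, Matrix.cons_val, eval_add, eval_sub, eval_mul,
      eval_pow, eval_X, eval_C, eval_one, eval_ofNat, eval_neg]
    ring
  have h0 : (derivNum (-1) polyT₀ 0).eval x = -1 := by
    simp [derivNum]
  have h1 : (derivNum (-1) polyT₀ 1).eval x = -2 := by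
    simp [derivNum, polyT₀]
  have h2 : (derivNum (-1) polyT₀ 2).eval x = -8 := by
    norm_num [derivNum, polyT₀]
  have hA₃ : (dihedralCoeff 3).eval x = 7 * polyP.eval x * polyT.eval x * polyT₀.eval x := by
    simp [dihedralCoeff]
  simp only [ratDeriv, h0, h1, h2, hA₃, zero_add, pow_one, Nat.reduceAdd]
  field_simp
  linear_combination hident

/-- The fourth root of `(21 - 8 x² + 4 t) / (21 + 4 t(0))` for a square root `t` of
`28 - 21 x² + 4 x⁴`; this is `Y₁` for `t = 2 S` and `Y₂` for `t = -2 S`. -/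
def fourthRoot (t : ℂ → ℂ) (x : ℂ) : ℂ :=
  ((21 - 8 * x ^ 2 + 4 * t x) / (21 + 4 * t 0)) ^ (1 / 4 : ℂ)

/-- The derivatives of the logarithmic derivative `-x / t` of `fourthRoot t`. -/
def logDerivFourthRoot (t : ℂ → ℂ) : ℕ → ℂ → ℂ
  | 0, x => -x / t x
  | 1, x => (4 * x ^ 4 - 28) / t x ^ 3
  | _, x => (-32 * x ^ 7 - 84 * x ^ 5 + 1120 * x ^ 3 - 1764 * x) / t x ^ 5

theorem eventually_polyT_ne_zero : ∀ᶠ x in 𝓝 0, polyT.eval x ≠ 0 :=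
  polyT.continuous.continuousAt.eventually_ne (by simp [polyT])

variable {t : ℂ → ℂ}

theorem eventually_ne_zero_of_sq_eq_polyT (hsq : ∀ᶠ x in 𝓝 0, t x ^ 2 = polyT.eval x) :
    ∀ᶠ x in 𝓝 0, t x ≠ 0 := by
  filter_upwards [hsq, eventually_polyT_ne_zero] with x hsqx hT
  exact (pow_ne_zero_iff two_ne_zero).1 (hsqx ▸ hT)

theorem eventually_hasDerivAt_of_sq_eq_polyT (ht : AnalyticAt ℂ t 0)
    (hsq : ∀ᶠ x in 𝓝 0, t x ^ 2 = polyT.eval x) :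
    ∀ᶠ x in 𝓝 0, HasDerivAt t ((8 * x ^ 3 - 21 * x) / t x) x := by
  filter_upwards [ht.eventually_analyticAt, eventually_eventually_nhds.2 hsq,
    eventually_ne_zero_of_sq_eq_polyT hsq] with x hx hsq ht0
  have hderiv := hx.differentiableAt.hasDerivAt
  have h2 : 2 * t x * deriv t x = (derivative polyT).eval x := by
    simpa using (hderiv.pow 2).unique ((polyT.hasDerivAt x).congr_of_eventuallyEq hsq)
  refine hderiv.congr_deriv ?_
  simp only [polyT, derivative_add, derivative_sub, derivative_mul, derivative_X_pow,
    derivative_ofNat, eval_add, eval_sub, eval_mul, eval_pow, eval_X, eval_C, eval_ofNat,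
    eval_zero, Nat.cast_ofNat, Nat.reduceSub] at h2
  field_simp
  linear_combination h2 / 2

theorem base_ne_zero_of_sq_eq_polyT (hsq : ∀ᶠ x in 𝓝 0, t x ^ 2 = polyT.eval x) :
    21 + 4 * t 0 ≠ 0 := by
  have h0 : t 0 ^ 2 = 28 := by simpa [polyT] using hsq.self_of_nhds
  intro h
  have : (7 : ℂ) = 0 := by linear_combination (4 * t 0 - 21) * h - 16 * h0
  norm_num at this

theorem eventually_hasDerivAt_fourthRoot (ht : AnalyticAt ℂ t 0)
    (hsq : ∀ᶠ x in 𝓝 0, t x ^ 2 = polyT.eval x) :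
    ∀ᶠ x in 𝓝 0, HasDerivAt (fourthRoot t) (logDerivFourthRoot t 0 x * fourthRoot t x) x := by
  have hbase := base_ne_zero_of_sq_eq_polyT hsq
  have hcont : ContinuousAt (fun x ↦ (21 - 8 * x ^ 2 + 4 * t x) / (21 + 4 * t 0)) 0 := by
    have := ht.continuousAt
    fun_prop
  filter_upwards [eventually_hasDerivAt_of_sq_eq_polyT ht hsq,
    eventually_ne_zero_of_sq_eq_polyT hsq,
    hcont.eventually (Complex.isOpen_slitPlane.mem_nhds (by simp [hbase]))] with x ht' ht0 hslit
  have hw : HasDerivAt (fun x ↦ (21 - 8 * x ^ 2 + 4 * t x) / (21 + 4 * t 0))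
      (-4 * x / t x * ((21 - 8 * x ^ 2 + 4 * t x) / (21 + 4 * t 0))) x := by
    refine ((((hasDerivAt_pow 2 x).const_mul 8).const_sub 21 |>.add (ht'.const_mul 4)).div_const
      (21 + 4 * t 0)).congr_deriv ?_
    field_simp
    ring
  refine (hasDerivAt_cpow_of_logDeriv (1 / 4) hw hslit).congr_deriv ?_
  simp only [fourthRoot, logDerivFourthRoot]
  ring

theorem eventually_hasDerivAt_logDerivFourthRoot (ht : AnalyticAt ℂ t 0)
    (hsq : ∀ᶠ x in 𝓝 0, t x ^ 2 = polyT.eval x) (i : ℕ) (hi : i < 2) :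
    ∀ᶠ x in 𝓝 0, HasDerivAt (logDerivFourthRoot t i) (logDerivFourthRoot t (i + 1) x) x := by
  filter_upwards [eventually_hasDerivAt_of_sq_eq_polyT ht hsq, hsq,
    eventually_ne_zero_of_sq_eq_polyT hsq] with x ht' hsqx ht0
  simp only [polyT, eval_add, eval_sub, eval_mul, eval_pow, eval_X, eval_ofNat] at hsqx
  interval_cases i
  · refine ((hasDerivAt_neg x).div ht' ht0).congr_deriv ?_
    simp only [logDerivFourthRoot]
    field_simp
    linear_combination -hsqx
  · refine ((((hasDerivAt_pow 4 x).const_mul 4).sub_const 28).div (ht'.pow 3)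
      (pow_ne_zero 3 ht0)).congr_deriv ?_
    simp only [logDerivFourthRoot, Pi.pow_apply]
    field_simp
    push_cast
    linear_combination 16 * x ^ 3 * t x ^ 2 * hsqx

theorem fourthRoot_mem_dihedralSolutions (ht : AnalyticAt ℂ t 0)
    (hsq : ∀ᶠ x in 𝓝 0, t x ^ 2 = polyT.eval x) : fourthRoot t ∈ dihedralSolutions := by
  refine mem_dihedralSolutions_of_logDeriv (l := logDerivFourthRoot t)
    (eventually_hasDerivAt_fourthRoot ht hsq) (eventually_hasDerivAt_logDerivFourthRoot ht hsq) ?_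
  filter_upwards [hsq, eventually_ne_zero_of_sq_eq_polyT hsq] with x hsqx ht0
  have hA₃ : (dihedralCoeff 3).eval x = 7 * polyP.eval x * t x ^ 2 * polyT₀.eval x := by
    simp [dihedralCoeff, hsqx]
  have heven : (dihedralCoeff 0).eval x * polyT.eval x + (dihedralCoeff 2).eval x * x ^ 2 -
      21 * x * (4 * x ^ 4 - 28) * (polyP.eval x * polyT₀.eval x) = 0 := by
    simp only [dihedralCoeff, polyP, polyT, polyT₀, Matrix.cons_val, eval_add, eval_sub, eval_mul,
      eval_pow, eval_X, eval_C, eval_one, eval_ofNat, eval_neg]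
    ring
  have hodd : -(dihedralCoeff 1).eval x * x * polyT.eval x +
      (dihedralCoeff 2).eval x * (4 * x ^ 4 - 28) + 7 * (polyP.eval x * polyT₀.eval x) *
        (-32 * x ^ 7 - 84 * x ^ 5 + 1120 * x ^ 3 - 1764 * x - x ^ 3 * polyT.eval x) = 0 := by
    simp only [dihedralCoeff, polyP, polyT, polyT₀, Matrix.cons_val, eval_add, eval_sub, eval_mul,
      eval_pow, eval_X, eval_C, eval_one, eval_ofNat, eval_neg]
    ring
  rw [← hsqx] at heven hodd
  simp only [logDerivFourthRoot, hA₃]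
  field_simp
  linear_combination t x * heven + hodd

end AlgebraicSolutions

section InitialValues

theorem S_sq (x : ℂ) : S x ^ 2 = 7 - 21 / 4 * x ^ 2 + x ^ 4 := by
  simp [S]

theorem S_zero : S 0 = sqrt7 := by
  simp [S, sqrt7, Real.sqrt_eq_rpow, Complex.ofReal_cpow]

theorem sqrt7_sq : sqrt7 ^ 2 = 7 := by
  simp [← S_zero, S_sq]

theorem sqrt7_ne_zero : sqrt7 ≠ 0 := by
  simp [sqrt7]

theorem analyticAt_S : AnalyticAt ℂ S 0 :=
  (show AnalyticAt ℂ (fun x : ℂ ↦ 7 - 21 / 4 * x ^ 2 + x ^ 4) 0 by fun_prop).cpow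
    analyticAt_const (by simp)

theorem const_mul_S_sq {k : ℂ} (hk : k ^ 2 = 4) (x : ℂ) : (k * S x) ^ 2 = polyT.eval x := by
  rw [mul_pow, hk, S_sq]
  simp only [polyT, eval_add, eval_sub, eval_mul, eval_pow, eval_X, eval_ofNat]
  ring

theorem Y1_eq : Y1 = fourthRoot (fun x ↦ 2 * S x) := by
  funext x
  simp only [Y1, fourthRoot, S_zero]
  ring_nf

theorem Y2_eq : Y2 = fourthRoot (fun x ↦ -2 * S x) := by
  funext x
  simp only [Y2, fourthRoot, S_zero]
  ring_nf

theorem Y1_mem_dihedralSolutions : Y1 ∈ dihedralSolutions :=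
  Y1_eq ▸ fourthRoot_mem_dihedralSolutions (analyticAt_const.mul analyticAt_S)
    (.of_forall (const_mul_S_sq (by norm_num)))

theorem Y2_mem_dihedralSolutions : Y2 ∈ dihedralSolutions :=
  Y2_eq ▸ fourthRoot_mem_dihedralSolutions (analyticAt_const.mul analyticAt_S)
    (.of_forall (const_mul_S_sq (by norm_num)))

theorem Y0_initialValues :
    Y0 0 = 1 ∧ iteratedDeriv 1 Y0 0 = -1 / 3 ∧ iteratedDeriv 2 Y0 0 = -1 / 9 := by
  have h0 : Y0 0 = 1 := by simp [Y0]
  obtain ⟨h1, h2, -⟩ := (eventually_iteratedDeriv_eq_of_logDeriv eventually_hasDerivAt_Y0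
    fun i _ ↦ eventually_polyT₀_ne_zero.mono fun x ↦ hasDerivAt_ratDeriv _ _ i).self_of_nhds
  rw [h1, h2, h0]
  refine ⟨rfl, ?_⟩
  norm_num [ratDeriv, derivNum, polyT₀]

theorem fourthRoot_initialValues {t : ℂ → ℂ} (ht : AnalyticAt ℂ t 0)
    (hsq : ∀ᶠ x in 𝓝 0, t x ^ 2 = polyT.eval x) :
    fourthRoot t 0 = 1 ∧ iteratedDeriv 1 (fourthRoot t) 0 = 0 ∧
      iteratedDeriv 2 (fourthRoot t) 0 = -1 / t 0 := by
  have h28 : t 0 ^ 2 = 28 := by simpa [polyT] using hsq.self_of_nhds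
  have ht0 : t 0 ≠ 0 := (eventually_ne_zero_of_sq_eq_polyT hsq).self_of_nhds
  have h0 : fourthRoot t 0 = 1 := by
    simp [fourthRoot, base_ne_zero_of_sq_eq_polyT hsq]
  obtain ⟨h1, h2, -⟩ := (eventually_iteratedDeriv_eq_of_logDeriv
    (eventually_hasDerivAt_fourthRoot ht hsq)
    (eventually_hasDerivAt_logDerivFourthRoot ht hsq)).self_of_nhds
  rw [h1, h2, h0]
  refine ⟨rfl, by simp [logDerivFourthRoot], ?_⟩
  simp only [logDerivFourthRoot]
  field_simp
  linear_combination h28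

theorem Y1_initialValues :
    Y1 0 = 1 ∧ iteratedDeriv 1 Y1 0 = 0 ∧ iteratedDeriv 2 Y1 0 = -sqrt7 / 14 := by
  obtain ⟨h0, h1, h2⟩ := fourthRoot_initialValues (t := fun x ↦ 2 * S x)
    (analyticAt_const.mul analyticAt_S) (.of_forall (const_mul_S_sq (by norm_num)))
  rw [← Y1_eq, S_zero] at *
  refine ⟨h0, h1, h2.trans ?_⟩
  field_simp [sqrt7_ne_zero]
  linear_combination 2 * sqrt7_sq

theorem Y2_initialValues :
    Y2 0 = 1 ∧ iteratedDeriv 1 Y2 0 = 0 ∧ iteratedDeriv 2 Y2 0 = sqrt7 / 14 := by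
  obtain ⟨h0, h1, h2⟩ := fourthRoot_initialValues (t := fun x ↦ -2 * S x)
    (analyticAt_const.mul analyticAt_S) (.of_forall (const_mul_S_sq (by norm_num)))
  rw [← Y2_eq, S_zero] at *
  refine ⟨h0, h1, h2.trans ?_⟩
  field_simp [sqrt7_ne_zero]
  linear_combination -2 * sqrt7_sq

theorem eventually_eq_of_mem_dihedralSolutions {f : ℂ → ℂ} (hf : f ∈ dihedralSolutions)
    {c₀ c₁ c₂ : ℂ} (h0 : f 0 = c₀ + c₁ + c₂) (h1 : iteratedDeriv 1 f 0 = -c₀ / 3)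
    (h2 : iteratedDeriv 2 f 0 = -c₀ / 9 + (c₂ - c₁) * sqrt7 / 14) :
    ∀ᶠ x in 𝓝 0, f x = c₀ * Y0 x + c₁ * Y1 x + c₂ * Y2 x := by
  have hY0 := Submodule.smul_mem _ c₀ Y0_mem_dihedralSolutions
  have hY1 := Submodule.smul_mem _ c₁ Y1_mem_dihedralSolutions
  have hY2 := Submodule.smul_mem _ c₂ Y2_mem_dihedralSolutions
  have hlast : (dihedralCoeff 3).eval 0 ≠ 0 := by simp [dihedralCoeff, polyP, polyT, polyT₀]
  refine eventuallyEq_of_mem_analyticSolutions hf (add_mem (add_mem hY0 hY1) hY2)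
    (fun i ↦ (dihedralCoeff i).differentiable.analyticAt 0) hlast fun i hi ↦ ?_
  change _ = iteratedDeriv i (c₀ • Y0 + c₁ • Y1 + c₂ • Y2) 0
  rw [iteratedDeriv_add (hY0.1.add hY1.1).contDiffAt hY2.1.contDiffAt,
    iteratedDeriv_add hY0.1.contDiffAt hY1.1.contDiffAt]
  simp only [iteratedDeriv_const_smul_field]
  obtain ⟨h00, h01, h02⟩ := Y0_initialValues
  obtain ⟨h10, h11, h12⟩ := Y1_initialValues
  obtain ⟨h20, h21, h22⟩ := Y2_initialValues
  interval_cases i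
  · simp only [iteratedDeriv_zero, h0, h00, h10, h20, smul_eq_mul, mul_one]
  · rw [h1, h01, h11, h21]
    simp only [smul_eq_mul]
    ring
  · rw [h2, h02, h12, h22]
    simp only [smul_eq_mul]
    ring

theorem three_le_analyticOrderAt_Psi3 : 3 ≤ analyticOrderAt Psi3 0 := by
  refine (natCast_le_analyticOrderAt (n := 3) analyticAt_Psi3).2
    ⟨fun x ↦ -(49 / 27) * Q3 x ^ 3 / polyP.eval x ^ 7, ?_, .of_forall fun x ↦ ?_⟩
  · have hQ : AnalyticAt ℂ Q3 0 := by
      unfold Q3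
      fun_prop
    exact (analyticAt_const.mul (hQ.pow 3)).div (polyP.differentiable.analyticAt 0 |>.pow 7)
      (by simp [polyP])
  · rw [Psi3_eq, ← mul_Q3_eq, smul_eq_mul]
    ring

theorem three_le_analyticOrderAt_comp_Psi3_sub {f : ℂ → ℂ} (hf : AnalyticAt ℂ f 0) :
    3 ≤ analyticOrderAt (fun x ↦ f (Psi3 x) - f 0) 0 := by
  have hf' : AnalyticAt ℂ (fun z ↦ f z - f 0) (Psi3 0) := by
    rw [Psi3_zero]
    exact hf.sub analyticAt_const
  have hone : 1 ≤ analyticOrderAt (fun z ↦ f z - f 0) (Psi3 0) := by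
    rw [Order.one_le_iff_ne_zero, hf'.analyticOrderAt_ne_zero, Psi3_zero, sub_self]
  have hcomp := hf'.analyticOrderAt_comp analyticAt_Psi3
  simp only [Psi3_zero, sub_zero] at hcomp hone
  calc (3 : ℕ∞) = 1 * 3 := (one_mul _).symm
    _ ≤ _ := mul_le_mul' hone three_le_analyticOrderAt_Psi3
    _ = _ := hcomp.symm

theorem iteratedDeriv_prefactor_mul_comp_Psi3 (j : ℕ) {f : ℂ → ℂ} (hf : AnalyticAt ℂ f 0)
    {i : ℕ} (hi : i < 3) : iteratedDeriv i (fun x ↦ prefactor j x * f (Psi3 x)) 0 =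
      f 0 * iteratedDeriv i (prefactor j) 0 :=
  iteratedDeriv_mul_eq_of_le_analyticOrderAt (analyticAt_prefactor j)
    (AnalyticAt.comp (by rwa [Psi3_zero]) analyticAt_Psi3)
    (three_le_analyticOrderAt_comp_Psi3_sub hf) hi

theorem P3_cpow_initialValues (c : ℂ) :
    P3 0 ^ c = 1 ∧ iteratedDeriv 1 (fun x ↦ P3 x ^ c) 0 = -c ∧
      iteratedDeriv 2 (fun x ↦ P3 x ^ c) 0 = c * (c - 1) := by
  have h0 : P3 0 ^ c = 1 := by simp [P3]
  have hl (i : ℕ) : ∀ᶠ x in 𝓝 0, HasDerivAt (ratDeriv (C c * derivative polyP) polyP i)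
      (ratDeriv (C c * derivative polyP) polyP (i + 1) x) x :=
    eventually_polyP_ne_zero.mono fun x ↦ hasDerivAt_ratDeriv _ _ i
  obtain ⟨h1, h2, -⟩ := (eventually_iteratedDeriv_eq_of_logDeriv
    (eventually_P3_mem_slitPlane.mono fun x ↦ hasDerivAt_P3_cpow c) fun i _ ↦ hl i).self_of_nhds
  rw [h1, h2, h0]
  refine ⟨rfl, ?_, ?_⟩
  · simp [ratDeriv, derivNum, polyP]
  · simp only [ratDeriv, derivNum, polyP, derivative_add, derivative_sub, derivative_mul,
      derivative_X_pow, derivative_X, derivative_C, derivative_one, derivative_zero, eval_add,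
      eval_sub, eval_mul, eval_pow, eval_X, eval_C, eval_one, eval_natCast, eval_zero,
      Nat.cast_ofNat, Nat.reduceSub]
    ring

theorem eval_mul_P3_cpow_initialValues (p : ℂ[X]) (c : ℂ) :
    p.eval 0 * P3 0 ^ c = p.eval 0 ∧
      iteratedDeriv 1 (fun x ↦ p.eval x * P3 x ^ c) 0 = (derivative p).eval 0 - c * p.eval 0 ∧
      iteratedDeriv 2 (fun x ↦ p.eval x * P3 x ^ c) 0 =
        (derivative (derivative p)).eval 0 - 2 * c * (derivative p).eval 0 +
          c * (c - 1) * p.eval 0 := by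
  obtain ⟨h0, h1, h2⟩ := P3_cpow_initialValues c
  have hp1 : iteratedDeriv 1 (fun x ↦ p.eval x) 0 = (derivative p).eval 0 := by
    rw [iteratedDeriv_one, Polynomial.deriv]
  have hp2 : iteratedDeriv 2 (fun x ↦ p.eval x) 0 = (derivative (derivative p)).eval 0 := by
    have hderiv : deriv (fun x ↦ p.eval x) = fun x ↦ (derivative p).eval x :=
      funext fun _ ↦ p.deriv
    rw [iteratedDeriv_succ', hderiv, iteratedDeriv_one, Polynomial.deriv]
  have hp (n : ℕ) : ContDiffAt ℂ n (fun x ↦ p.eval x) 0 :=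
    (p.differentiable.analyticAt 0).contDiffAt
  have hP (n : ℕ) : ContDiffAt ℂ n (fun x ↦ P3 x ^ c) 0 := (analyticAt_P3_cpow c).contDiffAt
  refine ⟨by rw [h0, mul_one], ?_, ?_⟩
  · simp only [iteratedDeriv_fun_mul (hp 1) (hP 1), Finset.sum_range_succ, Finset.sum_range_zero,
      Nat.choose, Nat.sub_zero, Nat.sub_self, iteratedDeriv_zero, h0, hp1, h1]
    push_cast
    ring
  · simp only [iteratedDeriv_fun_mul (hp 2) (hP 2), Finset.sum_range_succ, Finset.sum_range_zero,
      Nat.choose, Nat.sub_zero, Nat.sub_self, Nat.reduceSub, iteratedDeriv_zero, h0, hp1, h1, hp2,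
      h2]
    push_cast
    ring

theorem prefactor_initialValues (j : ℕ) :
    prefactor j 0 = (polyB ^ j).eval 0 ∧
      iteratedDeriv 1 (prefactor j) 0 =
        (derivative (polyB ^ j)).eval 0 - (1 / 6 - 7 / 3 * j) * (polyB ^ j).eval 0 ∧
      iteratedDeriv 2 (prefactor j) 0 =
        (derivative (derivative (polyB ^ j))).eval 0 -
          2 * (1 / 6 - 7 / 3 * j) * (derivative (polyB ^ j)).eval 0 +
          (1 / 6 - 7 / 3 * j) * (1 / 6 - 7 / 3 * j - 1) * (polyB ^ j).eval 0 := by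
  have h : prefactor j = fun x ↦ (polyB ^ j).eval x * P3 x ^ (1 / 6 - 7 / 3 * j : ℂ) :=
    funext fun x ↦ by rw [prefactor, eval_pow]
  rw [h]
  exact eval_mul_P3_cpow_initialValues _ _

theorem prefactor_zero_initialValues :
    prefactor 0 0 = 1 ∧ iteratedDeriv 1 (prefactor 0) 0 = -1 / 6 ∧
      iteratedDeriv 2 (prefactor 0) 0 = -5 / 36 := by
  obtain ⟨h0, h1, h2⟩ := prefactor_initialValues 0
  rw [h0, h1, h2]
  norm_num

theorem prefactor_one_initialValues :
    prefactor 1 0 = 0 ∧ iteratedDeriv 1 (prefactor 1) 0 = 1 ∧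
      iteratedDeriv 2 (prefactor 1) 0 = -1 / 6 := by
  obtain ⟨h0, h1, h2⟩ := prefactor_initialValues 1
  rw [h0, h1, h2]
  norm_num [polyB]

theorem prefactor_two_initialValues :
    prefactor 2 0 = 0 ∧ iteratedDeriv 1 (prefactor 2) 0 = 0 ∧
      iteratedDeriv 2 (prefactor 2) 0 = 2 := by
  obtain ⟨h0, h1, h2⟩ := prefactor_initialValues 2
  rw [h0, h1, h2]
  norm_num [polyB, derivative_pow]

end InitialValues

section Evaluations

theorem eventually_prefactor_mul_hyp32_eq (j : ℕ) {a b c d e : ℂ} (hd : ∀ n : ℕ, d + n ≠ 0)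
    (he : ∀ n : ℕ, e + n ≠ 0)
    (hlow : ∀ x, (x + 1 + j / 3) ^ 3 - (x + 1 + j / 3) ^ 2 + 2 / 9 * (x + 1 + j / 3) =
      (x + 1) * (x + d) * (x + e))
    (hup : ∀ x, (x + j / 3) ^ 3 + 1 / 2 * (x + j / 3) ^ 2 + 1 / 28 * (x + j / 3) - 85 / 74088 =
      (x + a) * (x + b) * (x + c))
    {c₀ c₁ c₂ : ℂ} (h0 : prefactor j 0 = c₀ + c₁ + c₂)
    (h1 : iteratedDeriv 1 (prefactor j) 0 = -c₀ / 3)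
    (h2 : iteratedDeriv 2 (prefactor j) 0 = -c₀ / 9 + (c₂ - c₁) * sqrt7 / 14) :
    ∀ᶠ x in 𝓝 0, prefactor j x * hyp32 a b c d e (Psi3 x) =
      c₀ * Y0 x + c₁ * Y1 x + c₂ * Y2 x := by
  have hf : AnalyticAt ℂ (hyp32 a b c d e) 0 := hasFPowerSeriesAt_hyp32.analyticAt
  have hsum (p : Fin 4 → ℂ) (y : ℂ) :
      ∑ k, p k * y ^ (k : ℕ) = p 0 + p 1 * y + p 2 * y ^ 2 + p 3 * y ^ 3 := by
    simp [Fin.sum_univ_four]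
  have hode := eventually_sum_euler_hyp32_eq hd he (s := j / 3) ![0, 2 / 9, -1, 1]
    ![-85 / 74088, 1 / 28, 1 / 2, 1]
    (fun x ↦ by rw [← hlow, hsum]; simp only [Matrix.cons_val]; ring)
    (fun x ↦ by rw [← hup, hsum]; simp only [Matrix.cons_val]; ring)
  refine eventually_eq_of_mem_dihedralSolutions
    (prefactor_mul_comp_Psi3_mem_dihedralSolutions j hf ?_) ?_ ?_ ?_
  · filter_upwards [hode] with z hz
    rw [Fin.sum_univ_four, Fin.sum_univ_four] at hz
    have hthree : ((3 : Fin 4) : ℕ) = 3 := rfl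
    simp only [Matrix.cons_val, Fin.val_zero, Fin.val_one, Fin.val_two, hthree,
      Function.iterate_one, Function.iterate_zero_apply] at hz
    linear_combination hz
  · rw [Psi3_zero, hyp32_zero, mul_one, h0]
  · rw [iteratedDeriv_prefactor_mul_comp_Psi3 j hf (by lia), hyp32_zero, one_mul, h1]
  · rw [iteratedDeriv_prefactor_mul_comp_Psi3 j hf (by lia), hyp32_zero, one_mul, h2]

theorem eventually_P3_cpow_mul_hyp32_eq :
    ∀ᶠ x in 𝓝 0, P3 x ^ (1 / 6 : ℂ) *
        hyp32 (-1 / 42) (5 / 42) (17 / 42) (1 / 3) (2 / 3) (Psi3 x) =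
      1 / 2 * Y0 x + (3 + sqrt7) / 12 * Y1 x + (3 - sqrt7) / 12 * Y2 x := by
  obtain ⟨h0, h1, h2⟩ := prefactor_zero_initialValues
  filter_upwards [eventually_prefactor_mul_hyp32_eq 0
    (a := -1 / 42) (b := 5 / 42) (c := 17 / 42) (d := 1 / 3) (e := 2 / 3)
    (c₀ := 1 / 2) (c₁ := (3 + sqrt7) / 12) (c₂ := (3 - sqrt7) / 12)
    (add_natCast_ne_zero_of_re_pos (by norm_num)) (add_natCast_ne_zero_of_re_pos (by norm_num))
    (fun x ↦ by push_cast; ring) (fun x ↦ by push_cast; ring)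
    (by rw [h0]; ring) (by rw [h1]; ring)
    (by rw [h2]; linear_combination sqrt7_sq / 84)] with x hx
  rw [← hx]
  simp [prefactor]

theorem eventually_mul_Q3_mul_P3_cpow_mul_hyp32_eq :
    ∀ᶠ x in 𝓝 0, x * Q3 x * P3 x ^ (-13 / 6 : ℂ) *
        hyp32 (13 / 42) (19 / 42) (31 / 42) (2 / 3) (4 / 3) (Psi3 x) =
      -3 * Y0 x + (3 + sqrt7) / 2 * Y1 x + (3 - sqrt7) / 2 * Y2 x := by
  obtain ⟨h0, h1, h2⟩ := prefactor_one_initialValues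
  filter_upwards [eventually_prefactor_mul_hyp32_eq 1
    (a := 13 / 42) (b := 19 / 42) (c := 31 / 42) (d := 2 / 3) (e := 4 / 3)
    (c₀ := -3) (c₁ := (3 + sqrt7) / 2) (c₂ := (3 - sqrt7) / 2)
    (add_natCast_ne_zero_of_re_pos (by norm_num)) (add_natCast_ne_zero_of_re_pos (by norm_num))
    (fun x ↦ by push_cast; ring) (fun x ↦ by push_cast; ring)
    (by rw [h0]; ring) (by rw [h1]; ring)
    (by rw [h2]; linear_combination sqrt7_sq / 14)] with x hx
  rw [← hx, prefactor, pow_one, mul_Q3_eq]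
  norm_num

theorem eventually_sq_mul_Q3_sq_mul_P3_cpow_mul_hyp32_eq :
    ∀ᶠ x in 𝓝 0, x ^ 2 * Q3 x ^ 2 * P3 x ^ (-9 / 2 : ℂ) *
        hyp32 (9 / 14) (11 / 14) (15 / 14) (4 / 3) (5 / 3) (Psi3 x) =
      -2 * sqrt7 * Y1 x + 2 * sqrt7 * Y2 x := by
  obtain ⟨h0, h1, h2⟩ := prefactor_two_initialValues
  filter_upwards [eventually_prefactor_mul_hyp32_eq 2
    (a := 9 / 14) (b := 11 / 14) (c := 15 / 14) (d := 4 / 3) (e := 5 / 3)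
    (c₀ := 0) (c₁ := -2 * sqrt7) (c₂ := 2 * sqrt7)
    (add_natCast_ne_zero_of_re_pos (by norm_num)) (add_natCast_ne_zero_of_re_pos (by norm_num))
    (fun x ↦ by push_cast; ring) (fun x ↦ by push_cast; ring)
    (by rw [h0]; ring) (by rw [h1]; ring)
    (by rw [h2]; linear_combination -2 / 7 * sqrt7_sq)] with x hx
  rw [zero_mul, zero_add] at hx
  rw [← hx, prefactor, ← mul_pow, mul_Q3_eq]
  norm_num

theorem eventually_norm_Psi3_lt_one : ∀ᶠ x in 𝓝 0, ‖Psi3 x‖ < 1 :=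
  analyticAt_Psi3.continuousAt.norm.eventually_lt_const (by simp [Psi3_zero])

end Evaluations

end DihedralEval

end

theorem mainTheorem1 :
    ∀ᶠ x : ℂ in 𝓝 0,
      (Summable (DihedralEval.hyp32Term (-1 / 42) (5 / 42) (17 / 42) (1 / 3) (2 / 3)
          (DihedralEval.Psi3 x)) ∧
        DihedralEval.P3 x ^ (1 / 6 : ℂ) *
            DihedralEval.hyp32 (-1 / 42) (5 / 42) (17 / 42) (1 / 3) (2 / 3)
              (DihedralEval.Psi3 x) =
          1 / 2 * DihedralEval.Y0 x
            + (3 + DihedralEval.sqrt7) / 12 * DihedralEval.Y1 x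
            + (3 - DihedralEval.sqrt7) / 12 * DihedralEval.Y2 x) ∧
      (Summable (DihedralEval.hyp32Term (13 / 42) (19 / 42) (31 / 42) (2 / 3) (4 / 3)
          (DihedralEval.Psi3 x)) ∧
        x * DihedralEval.Q3 x * DihedralEval.P3 x ^ (-13 / 6 : ℂ) *
            DihedralEval.hyp32 (13 / 42) (19 / 42) (31 / 42) (2 / 3) (4 / 3)
              (DihedralEval.Psi3 x) =
          -3 * DihedralEval.Y0 x
            + (3 + DihedralEval.sqrt7) / 2 * DihedralEval.Y1 x
            + (3 - DihedralEval.sqrt7) / 2 * DihedralEval.Y2 x) ∧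
      (Summable (DihedralEval.hyp32Term (9 / 14) (11 / 14) (15 / 14) (4 / 3) (5 / 3)
          (DihedralEval.Psi3 x)) ∧
        x ^ 2 * DihedralEval.Q3 x ^ 2 * DihedralEval.P3 x ^ (-9 / 2 : ℂ) *
            DihedralEval.hyp32 (9 / 14) (11 / 14) (15 / 14) (4 / 3) (5 / 3)
              (DihedralEval.Psi3 x) =
          -2 * DihedralEval.sqrt7 * DihedralEval.Y1 x
            + 2 * DihedralEval.sqrt7 * DihedralEval.Y2 x) := by
  filter_upwards [DihedralEval.eventually_norm_Psi3_lt_one,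
    DihedralEval.eventually_P3_cpow_mul_hyp32_eq,
    DihedralEval.eventually_mul_Q3_mul_P3_cpow_mul_hyp32_eq,
    DihedralEval.eventually_sq_mul_Q3_sq_mul_P3_cpow_mul_hyp32_eq] with x hΨ h0 h1 h2
  exact ⟨⟨DihedralEval.summable_hyp32Term hΨ, h0⟩, ⟨DihedralEval.summable_hyp32Term hΨ, h1⟩,
    ⟨DihedralEval.summable_hyp32Term hΨ, h2⟩⟩
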